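/- Let $r\ge1$, let $\mathbf m=(m_1,\ldots,m_r)$ be positive integers with $m=m_1+\cdots+m_r$, let $\mathbf f=(f_1,\ldots,f_r)\in\mathbb C^r$ with $f_j\notin\{0,-1,-2,\ldots\}$, and let $a,b\in\mathbb C$. Write $(z)_n=z(z+1)\cdots(z+n-1)$. The function $${}_{q+1}F_q\left(\begin{matrix}a_1,\ldots,a_{q+1}\\ b_1,\ldots,b_q\end{matrix}\,\Big|\,x\right)$$ is the analytic continuation to $\mathbb C\setminus[1,\infty)$ of the hypergeometric series $\sum_{n\ge0}\frac{(a_1)_n\cdots(a_{q+1})_n}{(b_1)_n\cdots(b_q)_n}\frac{x^n}{n!}$, $|x|<1$; when no argument is shown, a terminating sum at argument $1$ is meant. For a vector $\mathbf v$ and a number $s$ write $\mathbf v+s$ for the vector with $s$ added to each component. For $k\ge0$ put $$C_{k,r}=\frac{(-1)^k}{k!}\,{}_{r+1}F_r\left(\begin{matrix}-k,f_1+m_1,\ldots,f_r+m_r\\ f_1,\ldots,f_r\end{matrix}\right).$$ Suppose that $a+m\notin\{0,-1,-2,\ldots\}$, that $a-b\notin\{1-m,\ldots,-1,0\}$, and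 that $f_1\ne a$ if $m=r=1$. Let $\gamma=(\gamma_1,\ldots,\gamma_d)$ be the roots, listed with multiplicity, of the polynomial $$\hat R_{m-1}(t)=\frac{(-m)(-b)C_{0,r}}{a-b}\,{}_3F_2\left(\begin{matrix}-m+1,t+1,1-b\\2,a-b+1\end{matrix}\right)+\sum_{k=1}^m\frac{(-1)^kC_{k,r}(a)_k(b)_k(t+1)_{k-1}}{(1)_{k-1}(a-b)_k}\,{}_3F_2\left(\begin{matrix}-m+k,t+k,-b\\k,a-b+k\end{matrix}\right)$$ in $t$, so that $d=m-1$ for generic parameters and $d\le m-1$ always (if $\hat R_{m-1}\equiv0$, put $d=0$; the coefficient of the hypergeometric function on the right hand side below is then $0$), and suppose that the lower parameters $\gamma_i+1$ are not in $\{0,-1,-2,\ldots\}$. Then for all $x\in\mathbb C\setminus[1,\infty)$, with the principal branch of $(1-x)^b$, $$(1-x)^b\,{}_{r+2}F_{r+1}\left(\begin{matrix}a,b,f_1+m_1,\ldots,f_r+m_r\\a+m,f_1,\ldots,f_r\end{matrix}\,\Big|\,x\right)=1+x\,b\left(\frac{a\,(f_1+m_1)\cdots(f_r+m_r)}{(a+m)\,f_1\cdots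 f_r}-1\right){}_{d+2}F_{d+1}\left(\begin{matrix}1,a-b+1,\gamma+2\\a+m+1,\gamma+1\end{matrix}\,\Big|\,x\right).$$ For $d=m-1$ the function on the right hand side is an ${}_{m+1}F_m$. -/

import Mathlib

/-- The rising factorial (Pochhammer symbol) `(z)_n = z (z + 1) ⋯ (z + n - 1)`. -/
noncomputable def poch (z : ℂ) (n : ℕ) : ℂ := (ascPochhammer ℂ n).eval z

/-- The `n`-th Taylor coefficient `(a_1)_n ⋯ (a_p)_n / ((b_1)_n ⋯ (b_q)_n n!)` of the generalized
hypergeometric function with upper parameters `as` and lower parameters `bs`. -/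
noncomputable def hypCoeff (as bs : Multiset ℂ) (n : ℕ) : ℂ :=
  (as.map (fun a => poch a n)).prod / ((bs.map (fun b => poch b n)).prod * (n.factorial : ℂ))

/-- The cut plane `ℂ ∖ [1, ∞)`. -/
def cutPlane : Set ℂ := {x : ℂ | ∀ t : ℝ, 1 ≤ t → x ≠ (t : ℂ)}

/-- `F` is analytic on `ℂ ∖ [1, ∞)` and is given by the hypergeometric series on the unit disk. -/
def IsHypContinuation (as bs : Multiset ℂ) (F : ℂ → ℂ) : Prop :=
  AnalyticOnNhd ℂ F cutPlane ∧
    ∀ x : ℂ, ‖x‖ < 1 → HasSum (fun n : ℕ => hypCoeff as bs n * x ^ n) (F x)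

open Classical in
/-- The generalized hypergeometric function `_{q+1}F_q(as; bs; x)` on `ℂ ∖ [1, ∞)`: the analytic
continuation of its series from the unit disk. It is unique on `ℂ ∖ [1, ∞)`, see
`IsHypContinuation.eqOn` below, so that the choice does not matter. -/
noncomputable def hypF (as bs : Multiset ℂ) (x : ℂ) : ℂ :=
  if h : ∃ F : ℂ → ℂ, IsHypContinuation as bs F then h.choose x else 0

theorem mem_cutPlane_iff (x : ℂ) : x ∈ cutPlane ↔ 1 - x ∈ Complex.slitPlane := by
  rw [Complex.mem_slitPlane_iff, cutPlane, Set.mem_ofPred_eq]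
  constructor
  · intro h
    by_contra hc
    push Not at hc
    simp only [Complex.sub_re, Complex.one_re, Complex.sub_im, Complex.one_im] at hc
    refine h x.re (by linarith [hc.1]) (Complex.ext (by simp) ?_)
    simp only [Complex.ofReal_im]
    linarith [hc.2]
  · rintro h t ht rfl
    simp at h
    linarith

theorem isPreconnected_cutPlane : IsPreconnected cutPlane := by
  have h : cutPlane = (fun z : ℂ => 1 - z) '' Complex.slitPlane := by
    ext x
    rw [mem_cutPlane_iff]
    constructor
    · intro hx
      exact ⟨1 - x, hx, by ring⟩
    · rintro ⟨z, hz, rfl⟩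
      simpa using hz
  rw [h]
  refine IsPreconnected.image ?_ _ (by fun_prop)
  exact (Complex.starConvex_one_slitPlane.isPathConnected
    Complex.one_mem_slitPlane).isConnected.isPreconnected

/-- The analytic continuation is unique. -/
theorem IsHypContinuation.eqOn {as bs : Multiset ℂ} {F G : ℂ → ℂ}
    (hF : IsHypContinuation as bs F) (hG : IsHypContinuation as bs G) :
    Set.EqOn F G cutPlane := by
  refine hF.1.eqOn_of_preconnected_of_eventuallyEq hG.1 isPreconnected_cutPlane
    (z₀ := 0) ((mem_cutPlane_iff 0).2 (by simp)) ?_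
  filter_upwards [Metric.ball_mem_nhds (0 : ℂ) one_pos] with x hx
  have hx' : ‖x‖ < 1 := by simpa using hx
  exact (hF.2 x hx').unique (hG.2 x hx')

theorem hypF_spec {as bs : Multiset ℂ} {F : ℂ → ℂ} (hF : IsHypContinuation as bs F) :
    Set.EqOn (hypF as bs) F cutPlane := by
  intro x hx
  have h : ∃ F : ℂ → ℂ, IsHypContinuation as bs F := ⟨F, hF⟩
  rw [hypF, dif_pos h]
  exact h.choose_spec.eqOn hF hx

/-- The coefficient `C_{k,r} = (-1)^k / k! · _{r+1}F_r(-k, f + m; f; 1)`, a terminating sum. -/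
noncomputable def coeffC {r : ℕ} (f : Fin r → ℂ) (m : Fin r → ℕ) (k : ℕ) : ℂ :=
  (-1) ^ k / (k.factorial : ℂ) *
    ∑ j ∈ Finset.range (k + 1), poch (-(k : ℂ)) j * (∏ i, poch (f i + (m i : ℂ)) j) /
      ((∏ i, poch (f i) j) * (j.factorial : ℂ))

/-- The terminating function `₃F₂(-N, t + s, u; v, w; 1)`, as a polynomial in the variable `t`. -/
noncomputable def polyF32 (N : ℕ) (s u v w : ℂ) : Polynomial ℂ :=
  ∑ j ∈ Finset.range (N + 1),
    Polynomial.C (poch (-(N : ℂ)) j * poch u j / (poch v j * poch w j * (j.factorial : ℂ))) *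
      (ascPochhammer ℂ j).comp (Polynomial.X + Polynomial.C s)

/-- The polynomial `R̂_{M-1}(t)`, where `M = m_1 + ⋯ + m_r ≥ 1`. -/
noncomputable def polyRhat {r : ℕ} (a b : ℂ) (f : Fin r → ℂ) (m : Fin r → ℕ) : Polynomial ℂ :=
  let M : ℕ := ∑ i, m i
  Polynomial.C ((-(M : ℂ)) * (-b) * coeffC f m 0 / (a - b)) *
      polyF32 (M - 1) 1 (1 - b) 2 (a - b + 1) +
    ∑ k ∈ Finset.Icc 1 M,
      Polynomial.C ((-1) ^ k * coeffC f m k * poch a k * poch b k /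
          (poch 1 (k - 1) * poch (a - b) k)) *
        (ascPochhammer ℂ (k - 1)).comp (Polynomial.X + Polynomial.C 1) *
        polyF32 (M - k) (k : ℂ) (-b) (k : ℂ) (a - b + (k : ℂ))

/-! Write `M` for the sum of the `m i`. The quotient `∏ (f_i + m_i)_n / (f_i)_n` is a polynomial in
`n` of degree at most `M`, and its Newton expansion at `0` has coefficients `C_k`
(`ratio_eq_sum_coeffC`). So the hypergeometric function is `∑ C_k x^k F^(k)(x)` with `F = ₂F₁(a, b;
a + M; x)`. After multiplication by `(1 - x)^b`, the `N`-th Taylor coefficient of each summand is a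
terminating sum, which a consequence of the Pfaff–Saalschütz identity (`sum_poch_transform`) turns
into `(a - b)_N / (a + M)_N` times a polynomial in `t` taken at `t = -N`. Added up, these give `-(a
- b)_N / (a + M)_N * R̂(-N)` for `N ≥ 1` (`sum_antidiagonal_hypCoeff`). Factoring `R̂` over its
roots `γ` turns `R̂(-n - 1) / R̂(-1)` into `∏ (γ + 2)_n / (γ + 1)_n`, the coefficients on the
right-hand side.

It remains to pass from the disk to the cut plane. The left function continues because `(a)_n / (a +
M)_n` is rational in `n`: partial fractions reduce it to the binomial series with coefficients
divided by `n + s`, an Euler integral. The right function inherits its continuation from the left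
one by removing the constant term and dividing by `x`. -/

/-! ### Pochhammer symbols -/

theorem poch_zero (z : ℂ) : poch z 0 = 1 := by simp [poch]

theorem poch_succ (z : ℂ) (n : ℕ) : poch z (n + 1) = poch z n * (z + n) := by
  simp [poch, ascPochhammer_succ_eval]

theorem poch_one (z : ℂ) : poch z 1 = z := by simp [poch]

theorem poch_add (z : ℂ) (m n : ℕ) : poch z (m + n) = poch z m * poch (z + m) n := by
  induction n with
  | zero => simp [poch_zero]
  | succ n ih => rw [← add_assoc, poch_succ, poch_succ, ih]; push_cast; ring

theorem poch_succ_left (z : ℂ) (n : ℕ) : poch z (n + 1) = z * poch (z + 1) n := by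
  rw [add_comm, poch_add, poch_one]; simp

theorem poch_ne_zero {z : ℂ} {n : ℕ} (h : ∀ i < n, z ≠ -(i : ℂ)) : poch z n ≠ 0 := by
  induction n with
  | zero => simp [poch_zero]
  | succ n ih =>
    rw [poch_succ]
    refine mul_ne_zero (ih fun i hi => h i (by omega)) fun h0 => h n (by omega) ?_
    linear_combination h0

theorem poch_neg_natCast_of_lt {k n : ℕ} (h : k < n) : poch (-(k : ℂ)) n = 0 := by
  obtain ⟨d, rfl⟩ := Nat.exists_eq_add_of_lt h
  rw [add_right_comm, poch_add, poch_succ]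
  simp

theorem poch_reflect (z : ℂ) (n : ℕ) : poch z n = (-1) ^ n * poch (1 - z - n) n := by
  induction n generalizing z with
  | zero => simp [poch_zero]
  | succ n ih =>
    rw [poch_succ_left, ih, poch_succ]
    push_cast
    rw [show 1 - (z + 1) - (n : ℂ) = 1 - z - (n + 1) by ring]
    ring

theorem poch_one_left (n : ℕ) : poch 1 n = n.factorial := by
  rw [poch, ascPochhammer_eval_one]

theorem poch_two_left (n : ℕ) : poch 2 n = (n + 1).factorial := by
  rw [← poch_one_left, poch_succ_left]; norm_num

theorem factorial_mul_poch (k n : ℕ) :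
    (k.factorial : ℂ) * poch ((k : ℂ) + 1) n = (k + n).factorial := by
  rw [← poch_one_left, ← poch_one_left, poch_add, add_comm (k : ℂ)]

theorem poch_neg_natCast (k n : ℕ) (h : n ≤ k) :
    poch (-(k : ℂ)) n = (-1) ^ n * k.factorial / (k - n).factorial := by
  obtain ⟨d, rfl⟩ := Nat.exists_eq_add_of_le h
  rw [poch_reflect, Nat.add_sub_cancel_left, add_comm n d, ← factorial_mul_poch,
    show 1 - -((d + n : ℕ) : ℂ) - n = d + 1 by push_cast; ring]
  have := Nat.cast_ne_zero (R := ℂ).2 d.factorial_ne_zero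
  field_simp

open Finset in
/-- The Chu–Vandermonde identity. -/
theorem poch_add_left (x y : ℂ) (n : ℕ) :
    poch (x + y) n = ∑ p ∈ antidiagonal n, (n.choose p.1 : ℂ) * (poch x p.1 * poch y p.2) := by
  induction n with
  | zero => simp [poch_zero]
  | succ n ih =>
    rw [sum_antidiagonal_choose_succ_mul (fun i j => poch x i * poch y j), ← sum_add_distrib,
      poch_succ, ih, sum_mul]
    refine sum_congr rfl fun p hp => ?_
    obtain ⟨i, j⟩ := p
    obtain rfl := HasAntidiagonal.mem_antidiagonal.1 hp
    simp only
    rw [← Nat.choose_symm_add (a := i) (b := j), poch_succ, poch_succ]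
    push_cast
    ring

/-! ### The Pfaff–Saalschütz identity and a `₃F₂(1)` transformation -/

open Finset in
/-- The Pfaff–Saalschütz sum, cleared of denominators. -/
noncomputable def saalSum (α β x : ℂ) (n : ℕ) : ℂ :=
  ∑ p ∈ antidiagonal n, (n.choose p.1 : ℂ) *
    (poch x p.1 * poch α p.2 * poch β p.2 * poch (x + α + β + p.2) p.1)

-- Pascal's rule splits the sum for `n + 2` over the antidiagonal of `n + 1`; after `key` the
-- recurrence holds term by term. It involves only `x` and `x + 1`, so a two-step induction with `x`
-- free proves the identity without nonvanishing hypotheses.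
open Finset in
theorem saalSum_succ_succ (α β x : ℂ) (n : ℕ) :
    saalSum α β x (n + 2) =
      (x + α + (n + 1)) * (x + β + (n + 1)) *
        (saalSum α β x (n + 1) + (n + 1) * x * saalSum α β (x + 1) n) -
      (n + 1) * x * saalSum α β (x + 1) (n + 1) := by
  -- Absorption `i * C(n+1, i) = (n+1) * C(n, i-1)`; the truncated `p.1 - 1` at `p.1 = 0` is
  -- harmless because of the factor `p.1`.
  have key : ∑ p ∈ antidiagonal (n + 1), ((n + 1).choose p.1 : ℂ) *
      (p.1 * poch x p.1 * poch α p.2 * poch β p.2 * poch (x + α + β + p.2 + 1) (p.1 - 1)) =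
      (n + 1) * x * saalSum α β (x + 1) n := by
    rw [Nat.sum_antidiagonal_succ, saalSum, mul_sum]
    simp only [Nat.cast_zero, zero_mul, mul_zero, zero_add]
    refine sum_congr rfl fun p hp => ?_
    have h := congrArg (Nat.cast (R := ℂ)) (Nat.add_one_mul_choose_eq n p.1)
    push_cast at h
    rw [poch_succ_left x, Nat.add_sub_cancel,
      show x + 1 + α + β + (p.2 : ℂ) = x + α + β + p.2 + 1 by ring]
    push_cast
    linear_combination (-(x * poch (x + 1) p.1 * poch α p.2 * poch β p.2 *
      poch (x + α + β + p.2 + 1) p.1)) * h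
  rw [← key, saalSum, sum_antidiagonal_choose_succ_mul
    (fun i j => poch x i * poch α j * poch β j * poch (x + α + β + j) i), saalSum, saalSum,
    ← sum_add_distrib, ← sum_add_distrib, mul_sum, mul_sum, ← sum_sub_distrib]
  refine sum_congr rfl fun p hp => ?_
  obtain ⟨i, j⟩ := p
  have hij : i + j = n + 1 := HasAntidiagonal.mem_antidiagonal.1 hp
  have hc : ((n : ℂ) + 1) = i + j := by exact_mod_cast hij.symm
  simp only
  rw [← Nat.choose_symm_of_eq_add hij.symm, hc]
  have hx : x * poch (x + 1) i = poch x i * (x + i) := by rw [← poch_succ_left, poch_succ]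
  rw [poch_succ α, poch_succ β, poch_succ x, poch_succ_left _ i,
    show x + 1 + α + β + (j : ℂ) = x + α + β + j + 1 by ring]
  rcases i with _ | i
  · simp only [poch_zero]
    push_cast
    ring
  · rw [Nat.add_sub_cancel, poch_succ_left (x + α + β + j) i,
      poch_succ (x + α + β + j + 1) i]
    push_cast at hx ⊢
    rw [poch_succ (x + 1) i] at hx ⊢
    rw [show x + α + β + ((j : ℂ) + 1) = x + α + β + j + 1 by ring,
      poch_succ (x + α + β + j + 1) i]
    linear_combination ((i : ℂ) + 1 + j) * (((n + 1).choose (i + 1) : ℕ) : ℂ) * (poch α j * poch β j *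
      (poch (x + α + β + j + 1) i * (x + α + β + j + 1 + i))) * hx

theorem saalSum_eq (α β : ℂ) (n : ℕ) (x : ℂ) :
    saalSum α β x n = poch (x + α) n * poch (x + β) n := by
  induction n using Nat.twoStepInduction generalizing x with
  | zero => simp [saalSum, poch_zero]
  | one =>
    rw [saalSum, Finset.Nat.sum_antidiagonal_succ]
    simp [poch_one, poch_zero]
    ring
  | more n ih0 ih1 =>
    rw [saalSum_succ_succ, ih1, ih1, ih0, poch_succ (x + α) (n + 1), poch_succ (x + β) (n + 1), poch_succ (x + α),
      poch_succ (x + β),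
      show x + 1 + α = x + α + 1 by ring, show x + 1 + β = x + β + 1 by ring,
      poch_succ (x + α + 1), poch_succ (x + β + 1)]
    push_cast
    ring

open Finset in
theorem sum_antidiagonal_assoc {R : Type*} [AddCommMonoid R] (n : ℕ) (F : ℕ → ℕ → ℕ → R) :
    ∑ p ∈ antidiagonal n, ∑ q ∈ antidiagonal p.1, F q.1 q.2 p.2 =
      ∑ p ∈ antidiagonal n, ∑ q ∈ antidiagonal p.2, F p.1 q.1 q.2 := by
  rw [sum_sigma', sum_sigma']
  refine sum_nbij' (fun s => ⟨(s.2.1, s.2.2 + s.1.2), (s.2.2, s.1.2)⟩)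
    (fun s => ⟨(s.1.1 + s.2.1, s.2.2), (s.1.1, s.2.1)⟩) ?_ ?_ ?_ ?_ ?_ <;>
  · rintro ⟨⟨i, j⟩, k, l⟩ h
    simp only [mem_sigma, HasAntidiagonal.mem_antidiagonal] at h
    obtain ⟨h1, h2⟩ := h
    subst h1 h2
    simp [add_assoc]

open Finset in
/-- A transformation of terminating `₃F₂(1)` series, cleared of denominators. -/
theorem sum_poch_transform (α b k c : ℂ) (n : ℕ) :
    ∑ p ∈ antidiagonal n, (n.choose p.1 : ℂ) *
        (poch (-b) p.1 * poch α p.2 * poch (b + k) p.2 * poch (c + p.2) p.1) =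
      ∑ p ∈ antidiagonal n, (n.choose p.1 : ℂ) *
        ((-1) ^ p.1 * poch (k + α - c) p.1 * poch (-b) p.1 * poch (k + p.1) p.2 *
          poch (α - b + p.1) p.2) := by
  -- Reflection and Chu–Vandermonde trade `c` for `k + α - c`, leaving a last factor of the shape
  -- needed in a Saalschütz sum.
  have hexp : ∀ j p : ℕ, poch (c + p) j = ∑ q ∈ antidiagonal j, (j.choose q.1 : ℂ) *
      ((-1) ^ q.1 * poch (k + α - c) q.1 * poch (k + α + p + q.1) q.2) := by
    intro j p
    rw [poch_reflect, show 1 - (c + p) - (j : ℂ) = (k + α - c) + (1 - k - α - p - j) by ring,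
      poch_add_left, mul_sum]
    refine sum_congr rfl fun q hq => ?_
    obtain ⟨i, l⟩ := q
    obtain rfl := HasAntidiagonal.mem_antidiagonal.1 hq
    simp only
    rw [poch_reflect (1 - k - α - p - (i + l : ℕ)),
      show 1 - (1 - k - α - p - ((i + l : ℕ) : ℂ)) - l = k + α + p + i by push_cast; ring,
      pow_add]
    have h1 : ((-1 : ℂ) ^ l) * (-1) ^ l = 1 := by rw [← mul_pow]; simp
    linear_combination (((i + l).choose i : ℕ) : ℂ) * (-1) ^ i * poch (k + α - c) i *
      poch (k + α + p + i) l * h1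
  obtain ⟨F, hF⟩ : ∃ F : ℕ → ℕ → ℕ → ℂ, ∀ i l p, F i l p =
      ((i + l + p).choose (i + l) : ℂ) * ((i + l).choose i : ℂ) *
        (poch (-b) (i + l) * poch α p * poch (b + k) p *
          ((-1) ^ i * poch (k + α - c) i * poch (k + α + p + i) l)) := ⟨_, fun _ _ _ => rfl⟩
  calc _ = ∑ p ∈ antidiagonal n, ∑ q ∈ antidiagonal p.1, F q.1 q.2 p.2 := by
        refine sum_congr rfl fun p hp => ?_
        rw [hexp, mul_sum, mul_sum]
        refine sum_congr rfl fun q hq => ?_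
        rw [HasAntidiagonal.mem_antidiagonal] at hp hq
        rw [hF, hq, hp]
        ring
    _ = _ := by
        rw [sum_antidiagonal_assoc]
        refine sum_congr rfl fun p hp => ?_
        obtain ⟨i, m⟩ := p
        have hp := HasAntidiagonal.mem_antidiagonal.1 hp
        simp only at hp ⊢
        -- For fixed `i` the inner sum is Saalschützian with `x = -b + i`.
        have hS := saalSum_eq α (b + k) m (-b + i)
        rw [show -b + i + α = α - b + i by ring, show -b + i + (b + k) = k + i by ring] at hS
        rw [show (n.choose i : ℂ) * ((-1) ^ i * poch (k + α - c) i * poch (-b) i * poch (k + i) m *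
          poch (α - b + i) m) = (n.choose i : ℂ) * ((-1) ^ i * poch (k + α - c) i * poch (-b) i) *
          (poch (α - b + i) m * poch (k + i) m) by ring, ← hS, saalSum, mul_sum]
        refine sum_congr rfl fun q hq => ?_
        obtain ⟨l, s⟩ := q
        have hq := HasAntidiagonal.mem_antidiagonal.1 hq
        simp only at hq ⊢
        rw [hF]
        have hch := congrArg (Nat.cast (R := ℂ)) (Nat.choose_mul (n := n) (k := i + l) (s := i)
          (by omega))
        rw [show n - i = m by omega, show i + l - i = l by omega] at hch
        push_cast at hch
        rw [show i + l + s = n by omega, hch, poch_add,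
          show -b + i + α + (b + k) + (s : ℂ) = k + α + s + i by ring]
        ring

/-! ### Values of the terminating `₃F₂` at negative integers -/

theorem eval_polyF32 (N : ℕ) (s u v w t : ℂ) :
    (polyF32 N s u v w).eval t = ∑ j ∈ Finset.range (N + 1),
      poch (-(N : ℂ)) j * poch u j / (poch v j * poch w j * (j.factorial : ℂ)) *
        poch (t + s) j := by
  simp [polyF32, Polynomial.eval_finsetSum, poch]

theorem sum_range_eq_of_vanish {f : ℕ → ℂ} {m n : ℕ} (hm : ∀ j, m < j → f j = 0)
    (hn : ∀ j, n < j → f j = 0) :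
    ∑ j ∈ Finset.range (m + 1), f j = ∑ j ∈ Finset.range (n + 1), f j := by
  rw [Finset.eventually_constant_sum (N := m + 1) (fun j hj => hm j (by omega))
    (n := max m n + 1) (by omega) |>.symm,
    Finset.eventually_constant_sum (N := n + 1) (fun j hj => hn j (by omega))
    (n := max m n + 1) (by omega) |>.symm]

-- At `t + s = -n` the factor `(-n)_j / j!` is a signed binomial coefficient, and `(v)_n / (v)_j =
-- (v + j)_{n-j}`. Terms with `j > D` vanish through `(-D)_j`, which is why `w` is only constrained
-- up to `D`.
open Finset in
theorem sum_antidiagonal_eq_eval_polyF32 (D n : ℕ) (s u v w t : ℂ) (ht : t + s = -(n : ℂ))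
    (hv : ∀ j ≤ n, poch v j ≠ 0) (hw : ∀ j ≤ D, poch w j ≠ 0) :
    ∑ p ∈ antidiagonal n, (n.choose p.1 : ℂ) *
        ((-1) ^ p.1 * poch (-(D : ℂ)) p.1 * poch u p.1 * poch (v + p.1) p.2 *
          poch (w + p.1) p.2) =
      poch v n * poch w n * (polyF32 D s u v w).eval t := by
  rw [eval_polyF32, ht, sum_range_eq_of_vanish (m := D) (n := n), mul_sum,
    Nat.sum_antidiagonal_eq_sum_range_succ (fun i q => (n.choose i : ℂ) *
        ((-1) ^ i * poch (-(D : ℂ)) i * poch u i * poch (v + i) q * poch (w + i) q))]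
  · refine sum_congr rfl fun j hj => ?_
    have hj : j ≤ n := by simpa [Nat.lt_succ_iff] using hj
    rcases le_or_gt j D with hD | hD
    · obtain ⟨q, rfl⟩ := Nat.exists_eq_add_of_le hj
      have h1 := hv j hj
      have h2 := hw j hD
      have h3 := Nat.cast_ne_zero (R := ℂ).2 j.factorial_ne_zero
      have h4 := Nat.cast_ne_zero (R := ℂ).2 q.factorial_ne_zero
      rw [poch_neg_natCast _ _ hj, Nat.add_sub_cancel_left, poch_add v, poch_add w,
        Nat.cast_add_choose]
      field_simp
    · simp [poch_neg_natCast_of_lt hD]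
  · intro j hj
    simp [poch_neg_natCast_of_lt hj]
  · intro j hj
    simp [poch_neg_natCast_of_lt hj]

/-! ### Taylor coefficients of `(1 - x)^b x^k` times derivatives of `₂F₁` -/

theorem poch_natCast_ne_zero {k : ℕ} (hk : k ≠ 0) (n : ℕ) : poch (k : ℂ) n ≠ 0 := by
  refine poch_ne_zero fun i _ h => ?_
  have : ((k + i : ℕ) : ℂ) = 0 := by push_cast; linear_combination h
  exact hk (by have := Nat.cast_eq_zero.1 this; omega)

/-- The coefficient of `x ^ N` in `(1 - x) ^ b * x ^ k * F^(k)`, where `F^(k)` is the `k`-th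
derivative of `₂F₁(a, b; c; x)`. -/
noncomputable def derivCoeff (a b c : ℂ) (k N : ℕ) : ℂ :=
  ∑ p ∈ Finset.HasAntidiagonal.antidiagonal N, poch (-b) p.1 / (p.1.factorial : ℂ) *
    ((p.2.descFactorial k : ℂ) *
      (poch a p.2 * poch b p.2 / (poch c p.2 * (p.2.factorial : ℂ))))

open Finset in
theorem derivCoeff_eq_zero_of_lt (a b c : ℂ) {k N : ℕ} (h : N < k) :
    derivCoeff a b c k N = 0 := by
  refine sum_eq_zero fun p hp => ?_
  have := HasAntidiagonal.mem_antidiagonal.1 hp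
  rw [Nat.descFactorial_of_lt (by omega)]
  simp

-- Only indices `p.2 ≥ k` contribute; shifting them by `k` gives the sum transformed by
-- `sum_poch_transform` with `a + k`, `c + k`. For `c = a + M` the factor `a - c + k = -(M - k)`
-- makes the new sum terminate.
open Finset in
theorem derivCoeff_add (a b c : ℂ) (hc : ∀ n, poch c n ≠ 0) (k n : ℕ) :
    derivCoeff a b c k (k + n) =
      poch a k * poch b k / (poch c (k + n) * (n.factorial : ℂ)) *
        ∑ p ∈ antidiagonal n, (n.choose p.1 : ℂ) *
          ((-1) ^ p.1 * poch (a - c + k) p.1 * poch (-b) p.1 * poch (k + p.1) p.2 *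
            poch (a - b + k + p.1) p.2) := by
  have h := sum_poch_transform (a + k) b k (c + k) n
  rw [show (k : ℂ) + (a + k) - (c + k) = a - c + k by ring,
    show a + k - b = a - b + k by ring] at h
  rw [← h, derivCoeff, mul_sum]
  symm
  refine sum_of_injOn (fun p => (p.1, k + p.2)) ?_ ?_ ?_ ?_
  · rintro ⟨i, j⟩ _ ⟨i', j'⟩ _ h
    simp only [Prod.mk.injEq] at h ⊢
    omega
  · rintro ⟨i, j⟩ hp
    simp only [mem_coe, HasAntidiagonal.mem_antidiagonal] at hp ⊢
    omega
  · rintro ⟨i, j⟩ hp hn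
    have hp := HasAntidiagonal.mem_antidiagonal.1 hp
    simp only at hp
    rw [Nat.descFactorial_of_lt]
    · simp
    by_contra! hkj
    obtain ⟨q, rfl⟩ := Nat.exists_eq_add_of_le hkj
    refine hn ⟨(i, q), ?_, rfl⟩
    simp only [mem_coe, HasAntidiagonal.mem_antidiagonal]
    omega
  · rintro ⟨i, j⟩ hp
    have hp := HasAntidiagonal.mem_antidiagonal.1 hp
    simp only at hp ⊢
    subst hp
    have h1 := hc (k + j)
    have h2 := hc (k + (i + j))
    have h3 := Nat.cast_ne_zero (R := ℂ).2 i.factorial_ne_zero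
    have h4 := Nat.cast_ne_zero (R := ℂ).2 j.factorial_ne_zero
    have h5 := Nat.cast_ne_zero (R := ℂ).2 (k + j).factorial_ne_zero
    have h6 := Nat.cast_ne_zero (R := ℂ).2 (i + j).factorial_ne_zero
    have h7 : (j.factorial : ℂ) * ((k + j).descFactorial k : ℂ) = (k + j).factorial := by
      have := Nat.factorial_mul_descFactorial (Nat.le_add_right k j)
      rw [Nat.add_sub_cancel_left] at this
      exact_mod_cast this
    have h8 : poch c (k + (i + j)) = poch c (k + j) * poch (c + k + j) i := by
      rw [show k + (i + j) = k + j + i by omega, poch_add]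
      push_cast
      rw [add_assoc]
    have h9 : poch (c + k + j) i ≠ 0 := fun h => h2 (by rw [h8, h, mul_zero])
    rw [h8, ← h7, poch_add a, poch_add b, Nat.cast_add_choose]
    rw [← h7] at h5
    have h10 := (mul_ne_zero_iff.1 h5).2
    field_simp

/-- The `k`-th term of `polyRhat`. -/
theorem derivCoeff_eq_eval {a b : ℂ} {M : ℕ} (hc : ∀ n, poch (a + M) n ≠ 0)
    (hab : ∀ k : ℕ, k < M → a - b ≠ -(k : ℂ)) {k N : ℕ} (hk : 1 ≤ k) (hkM : k ≤ M)
    (hN : 1 ≤ N) :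
    derivCoeff a b (a + M) k N = -(poch (a - b) N / poch (a + M) N) *
      ((-1) ^ k * poch a k * poch b k / (poch 1 (k - 1) * poch (a - b) k) *
        poch (-(N : ℂ) + 1) (k - 1) *
        (polyF32 (M - k) (k : ℂ) (-b) (k : ℂ) (a - b + (k : ℂ))).eval (-(N : ℂ))) := by
  obtain ⟨l, rfl⟩ := Nat.exists_eq_add_of_le' hk
  rw [Nat.add_sub_cancel]
  have hN1 : -(N : ℂ) + 1 = -((N - 1 : ℕ) : ℂ) := by rw [Nat.cast_sub hN]; push_cast; ring
  -- For `N < k` both sides vanish, the right one through `(1 - N)_{k-1}`.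
  rcases lt_or_ge N (l + 1) with hlt | hge
  · rw [derivCoeff_eq_zero_of_lt _ _ _ hlt, hN1, poch_neg_natCast_of_lt (by omega)]
    simp
  · obtain ⟨n, rfl⟩ := Nat.exists_eq_add_of_le hge
    have hab0 : ∀ j, j ≤ M → poch (a - b) j ≠ 0 := fun j hj =>
      poch_ne_zero fun i hi => hab i (by omega)
    have hsum := sum_antidiagonal_eq_eval_polyF32 (M - (l + 1)) n ((l + 1 : ℕ) : ℂ) (-b)
      ((l + 1 : ℕ) : ℂ) (a - b + ((l + 1 : ℕ) : ℂ)) (-((l + 1 + n : ℕ) : ℂ))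
      (by push_cast; ring) (fun j _ => poch_natCast_ne_zero (by omega) j) (fun j hj h0 =>
        hab0 (l + 1 + j) (by omega) (by rw [poch_add, h0, mul_zero]))
    rw [derivCoeff_add _ _ _ hc,
      show a - (a + M) + ((l + 1 : ℕ) : ℂ) = -((M - (l + 1) : ℕ) : ℂ) by
        rw [Nat.cast_sub hkM]; push_cast; ring,
      hsum, hN1, poch_neg_natCast _ _ (by omega), poch_one_left, poch_add (a - b) (l + 1) n,
      show l + 1 + n - 1 - l = n by omega, show l + 1 + n - 1 = l + n by omega,
      ← factorial_mul_poch]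
    have h1 := hab0 (l + 1) hkM
    have h2 := hc (l + 1 + n)
    have h3 := Nat.cast_ne_zero (R := ℂ).2 l.factorial_ne_zero
    have h4 := Nat.cast_ne_zero (R := ℂ).2 n.factorial_ne_zero
    push_cast
    rw [pow_succ]
    rcases neg_one_pow_eq_or ℂ l with h5 | h5 <;> rw [h5] <;> field_simp

-- For `k = 0` the lower parameter `k` of the `₃F₂` degenerates. The term `p.1 = 0` then drops out
-- through `(0)_N = 0`, and shifting the index by one produces the parameters `1 - b`, `2`, `a - b +
-- 1` of the exceptional first term of `polyRhat`.
open Finset in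
theorem derivCoeff_zero_eq_eval {a b : ℂ} {M : ℕ} (hM : 1 ≤ M) (hc : ∀ n, poch (a + M) n ≠ 0)
    (hab : ∀ k : ℕ, k < M → a - b ≠ -(k : ℂ)) {N : ℕ} (hN : 1 ≤ N) :
    derivCoeff a b (a + M) 0 N = -(poch (a - b) N / poch (a + M) N) *
      ((-(M : ℂ)) * (-b) / (a - b) *
        (polyF32 (M - 1) 1 (1 - b) 2 (a - b + 1)).eval (-(N : ℂ))) := by
  obtain ⟨n, rfl⟩ := Nat.exists_eq_add_of_le' hN
  have hab0 : ∀ j, j ≤ M → poch (a - b) j ≠ 0 := fun j hj =>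
    poch_ne_zero fun i hi => hab i (by omega)
  have hsum := sum_antidiagonal_eq_eval_polyF32 (M - 1) n 1 (1 - b)
    2 (a - b + 1) (-((n + 1 : ℕ) : ℂ))
    (by push_cast; ring) (fun j _ => by simpa using poch_natCast_ne_zero two_ne_zero j)
    (fun j hj h0 =>
      hab0 (j + 1) (by omega) (by rw [poch_succ_left, h0, mul_zero]))
  have h := derivCoeff_add a b (a + M) hc 0 (n + 1)
  rw [zero_add, Nat.sum_antidiagonal_succ] at h
  have hz : poch ((0 : ℕ) + ((0 : ℕ) : ℂ)) (n + 1) = 0 := by rw [poch_succ_left]; simp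
  rw [hz] at h
  have hs : ∑ p ∈ antidiagonal n, ((n + 1).choose (p.1 + 1) : ℂ) *
      ((-1) ^ (p.1 + 1) * poch (a - (a + M) + (0 : ℕ)) (p.1 + 1) * poch (-b) (p.1 + 1) *
        poch ((0 : ℕ) + ((p.1 + 1 : ℕ) : ℂ)) p.2 *
        poch (a - b + (0 : ℕ) + ((p.1 + 1 : ℕ) : ℂ)) p.2) =
      -(M * b) * (poch 2 n * poch (a - b + 1) n *
        (polyF32 (M - 1) 1 (1 - b) 2 (a - b + 1)).eval (-((n + 1 : ℕ) : ℂ))) := by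
    rw [← hsum, mul_sum]
    refine sum_congr rfl fun p hp => ?_
    obtain ⟨i, q⟩ := p
    obtain rfl := HasAntidiagonal.mem_antidiagonal.1 hp
    simp only
    have hi : ((i : ℂ) + 1) ≠ 0 := Nat.cast_add_one_ne_zero i
    have h1 := congrArg (Nat.cast (R := ℂ)) (Nat.add_one_mul_choose_eq (i + q) i)
    have h2 : ((i : ℂ) + 1) * poch (2 + i) q = poch (i + 1) q * (i + 1 + q) := by
      rw [← poch_succ, poch_succ_left, show (i : ℂ) + 1 + 1 = 2 + i by ring]
    push_cast at h1
    have h3 : ((i + q + 1).choose (i + 1) : ℂ) * poch (i + 1) q =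
        ((i + q).choose i : ℂ) * poch (2 + i) q := by
      apply mul_left_cancel₀ hi
      linear_combination (-poch (i + 1) q) * h1 - ((i + q).choose i : ℂ) * h2
    rw [poch_succ_left (-b), poch_succ_left (a - (a + M) + _),
      show a - (a + M) + ((0 : ℕ) : ℂ) + 1 = -((M - 1 : ℕ) : ℂ) by
        rw [Nat.cast_sub hM]; push_cast; ring, show -b + 1 = 1 - b by ring]
    push_cast
    rw [show (0 : ℂ) + (i + 1) = i + 1 by ring,
      show a - b + 0 + ((i : ℂ) + 1) = a - b + 1 + i by ring, pow_succ]
    linear_combination (M : ℂ) * (-b) * (-1) ^ i * poch (-((M - 1 : ℕ) : ℂ)) i * poch (1 - b) i *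
      poch (a - b + 1 + i) q * h3
  rw [hs, poch_two_left] at h
  rw [h, poch_succ_left (a - b)]
  have h1 : a - b ≠ 0 := by simpa using hab 0 (by omega)
  have h2 := hc (n + 1)
  have h4 := Nat.cast_ne_zero (R := ℂ).2 (n + 1).factorial_ne_zero
  simp only [poch_zero, mul_zero, zero_mul, zero_add]
  field_simp

/-! ### Newton expansion of the parameter quotient -/

theorem poch_comm (z : ℂ) (m n : ℕ) :
    poch z n * poch (z + n) m = poch z m * poch (z + m) n := by
  rw [← poch_add, ← poch_add, add_comm]

/-- Each factor is `(f + m)_n / (f)_n = (f + n)_m / (f)_m`, of degree `m` in `n`. -/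
theorem exists_polynomial_ratio {r : ℕ} (f : Fin r → ℂ) (m : Fin r → ℕ)
    (hf : ∀ (i : Fin r) (n : ℕ), f i ≠ -(n : ℂ)) :
    ∃ P : Polynomial ℂ, P.natDegree ≤ ∑ i, m i ∧ ∀ n : ℕ,
      P.eval (n : ℂ) = (∏ i, poch (f i + (m i : ℂ)) n) / ∏ i, poch (f i) n := by
  refine ⟨∏ i, (Polynomial.C (poch (f i) (m i))⁻¹ *
    (ascPochhammer ℂ (m i)).comp (Polynomial.X + Polynomial.C (f i))), ?_, fun n => ?_⟩
  · refine (Polynomial.natDegree_prod_le _ _).trans (Finset.sum_le_sum fun i _ => ?_)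
    refine (Polynomial.natDegree_C_mul_le _ _).trans ?_
    rw [Polynomial.natDegree_comp, ascPochhammer_natDegree, Polynomial.natDegree_X_add_C, mul_one]
  · rw [Polynomial.eval_prod, ← Finset.prod_div_distrib]
    refine Finset.prod_congr rfl fun i _ => ?_
    have h1 : ∀ n, poch (f i) n ≠ 0 := fun n => poch_ne_zero fun j _ => hf i j
    have h2 := h1 n
    have h3 := h1 (m i)
    have h4 := poch_comm (f i) (m i) n
    simp only [Polynomial.eval_mul, Polynomial.eval_C, Polynomial.eval_comp, Polynomial.eval_add,
      Polynomial.eval_X]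
    change _ * poch _ _ = _
    rw [add_comm (n : ℂ)]
    field_simp
    linear_combination h4

-- Since `(-1)^k (-k)_j / j! = (-1)^(k-j) C(k, j)`, the sum defining `coeffC` is a forward
-- difference at `0`, which sees `u` only at natural numbers.
open Finset in
theorem factorial_mul_coeffC {r : ℕ} (f : Fin r → ℂ) (m : Fin r → ℕ) {u : ℂ → ℂ}
    (hu : ∀ n : ℕ, u (n : ℂ) = (∏ i, poch (f i + (m i : ℂ)) n) / ∏ i, poch (f i) n) (k : ℕ) :
    (k.factorial : ℂ) * coeffC f m k = (fwdDiff 1)^[k] u 0 := by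
  have hk := Nat.cast_ne_zero (R := ℂ).2 k.factorial_ne_zero
  rw [coeffC, fwdDiff_iter_eq_sum_shift, ← mul_assoc, mul_div_cancel₀ _ hk, mul_sum]
  refine sum_congr rfl fun j hj => ?_
  have hj : j ≤ k := by simpa [Nat.lt_succ_iff] using hj
  obtain ⟨l, rfl⟩ := Nat.exists_eq_add_of_le hj
  rw [poch_neg_natCast _ _ hj, zsmul_eq_mul]
  have h1 := hu j
  rw [show (0 : ℂ) + j • (1 : ℂ) = j by simp, h1, Nat.add_sub_cancel_left]
  push_cast
  rw [Nat.cast_add_choose, pow_add]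
  have h3 := Nat.cast_ne_zero (R := ℂ).2 j.factorial_ne_zero
  have h4 := Nat.cast_ne_zero (R := ℂ).2 l.factorial_ne_zero
  rcases neg_one_pow_eq_or ℂ j with h | h <;> rw [h] <;> field_simp

open Finset in
/-- Newton's forward difference formula for `∏ (f_i + m_i)_n / (f_i)_n`. -/
theorem ratio_eq_sum_coeffC {r : ℕ} (f : Fin r → ℂ) (m : Fin r → ℕ)
    (hf : ∀ (i : Fin r) (n : ℕ), f i ≠ -(n : ℂ)) (n : ℕ) :
    (∏ i, poch (f i + (m i : ℂ)) n) / ∏ i, poch (f i) n =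
      ∑ k ∈ range (∑ i, m i + 1), coeffC f m k * (n.descFactorial k : ℂ) := by
  obtain ⟨P, hP, hu⟩ := exists_polynomial_ratio f m hf
  have h := shift_eq_sum_fwdDiff_iter (1 : ℂ) P.eval n 0
  rw [show (0 : ℂ) + n • (1 : ℂ) = n by simp, hu] at h
  rw [h, sum_congr rfl (g := fun k => coeffC f m k * (n.descFactorial k : ℂ)) fun k _ => ?_]
  -- Newton's sum stops at `n`, the claimed one at `M`: the falling factorial vanishes for `k > n`,
  -- the differences for `k > M`.
  · refine sum_range_eq_of_vanish (fun k hk => ?_) (fun k hk => ?_)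
    · rw [Nat.descFactorial_of_lt hk]
      simp
    · have h0 := factorial_mul_coeffC f m (u := fun z => P.eval z) hu k
      rw [P.fwdDiff_iter_eq_zero_of_degree_lt (by omega)] at h0
      have := (mul_eq_zero.1 h0).resolve_left (Nat.cast_ne_zero.2 k.factorial_ne_zero)
      rw [this, zero_mul]
  · rw [← factorial_mul_coeffC f m (u := fun z => P.eval z) hu k, Nat.descFactorial_eq_factorial_mul_choose, nsmul_eq_mul]
    push_cast
    ring

theorem hypCoeff_eq {r : ℕ} (a b c : ℂ) (f : Fin r → ℂ) (m : Fin r → ℕ) (n : ℕ) :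
    hypCoeff (a ::ₘ b ::ₘ Finset.univ.val.map (fun i => f i + (m i : ℂ)))
      (c ::ₘ Finset.univ.val.map f) n =
    ((∏ i, poch (f i + (m i : ℂ)) n) / ∏ i, poch (f i) n) *
      (poch a n * poch b n / (poch c n * (n.factorial : ℂ))) := by
  rw [hypCoeff]
  simp only [Multiset.map_cons, Multiset.prod_cons, Multiset.map_map, Function.comp_def]
  simp only [Finset.prod]
  rw [div_mul_div_comm]
  congr 1 <;> ring

open Finset in
/-- The Taylor coefficients of the left hand side at positive indices. -/
theorem sum_antidiagonal_hypCoeff {r : ℕ} {a b : ℂ} {f : Fin r → ℂ} {m : Fin r → ℕ} {M : ℕ}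
    (hM : M = ∑ i, m i) (hM1 : 1 ≤ M) (hf : ∀ (i : Fin r) (n : ℕ), f i ≠ -(n : ℂ))
    (haM : ∀ n : ℕ, a + (M : ℂ) ≠ -(n : ℂ)) (hab : ∀ k : ℕ, k < M → a - b ≠ -(k : ℂ))
    {N : ℕ} (hN : 1 ≤ N) :
    ∑ p ∈ antidiagonal N, poch (-b) p.1 / (p.1.factorial : ℂ) *
        hypCoeff (a ::ₘ b ::ₘ univ.val.map (fun i => f i + (m i : ℂ)))
          ((a + (M : ℂ)) ::ₘ univ.val.map f) p.2 =
      -(poch (a - b) N / poch (a + M) N) * (polyRhat a b f m).eval (-(N : ℂ)) := by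
  have hc : ∀ n, poch (a + M) n ≠ 0 := fun n => poch_ne_zero fun i _ => haM i
  have h1 : ∑ p ∈ antidiagonal N, poch (-b) p.1 / (p.1.factorial : ℂ) *
        hypCoeff (a ::ₘ b ::ₘ univ.val.map (fun i => f i + (m i : ℂ)))
          ((a + (M : ℂ)) ::ₘ univ.val.map f) p.2 =
      ∑ k ∈ range (M + 1), coeffC f m k * derivCoeff a b (a + M) k N := by
    simp only [hypCoeff_eq, ratio_eq_sum_coeffC f m hf, ← hM, derivCoeff, sum_mul, mul_sum]
    rw [sum_comm]
    refine sum_congr rfl fun k _ => sum_congr rfl fun p _ => ?_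
    ring
  rw [h1, range_eq_Ico, sum_eq_sum_Ico_succ_bot (by omega), polyRhat, ← hM,
    derivCoeff_zero_eq_eval hM1 hc hab hN]
  simp only [Polynomial.eval_add, Polynomial.eval_mul, Polynomial.eval_C,
    Polynomial.eval_finsetSum, Polynomial.eval_comp, Polynomial.eval_X]
  rw [mul_add, mul_sum]
  congr 1
  · ring
  · refine sum_congr (by ext; simp) fun k hk => ?_
    rw [mem_Icc] at hk
    rw [derivCoeff_eq_eval hc hab (by omega) (by omega) hN]
    change _ = _ * (_ * poch _ _ * _)
    ring

/-! ### Analytic functions on the cut plane and their Taylor coefficients -/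

theorem isOpen_cutPlane : IsOpen cutPlane := by
  have h : cutPlane = (fun x : ℂ => 1 - x) ⁻¹' Complex.slitPlane := by
    ext x
    exact mem_cutPlane_iff x
  rw [h]
  exact Complex.isOpen_slitPlane.preimage (by fun_prop)

theorem zero_mem_cutPlane : (0 : ℂ) ∈ cutPlane := (mem_cutPlane_iff 0).2 (by simp)

theorem smul_mem_cutPlane {x : ℂ} (hx : x ∈ cutPlane) {t : ℝ} (ht : t ∈ Set.Icc (0 : ℝ) 1) :
    (t : ℂ) * x ∈ cutPlane := by
  rw [mem_cutPlane_iff] at hx ⊢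
  have h := Complex.starConvex_one_slitPlane hx (a := 1 - t) (b := t) (by linarith [ht.2]) ht.1
    (by ring)
  convert h using 1
  simp only [Complex.real_smul]
  push_cast
  ring

/-- `F` is analytic on the cut plane, with Taylor coefficients `h` on the unit disk. -/
def IsCutSeries (h : ℕ → ℂ) (F : ℂ → ℂ) : Prop :=
  AnalyticOnNhd ℂ F cutPlane ∧ ∀ x : ℂ, ‖x‖ < 1 → HasSum (fun n : ℕ => h n * x ^ n) (F x)

namespace IsCutSeries

variable {h g : ℕ → ℂ} {F G : ℂ → ℂ}

theorem eqOn (hF : IsCutSeries h F) (hG : IsCutSeries h G) : Set.EqOn F G cutPlane := by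
  refine hF.1.eqOn_of_preconnected_of_eventuallyEq hG.1 isPreconnected_cutPlane
    zero_mem_cutPlane ?_
  filter_upwards [Metric.ball_mem_nhds (0 : ℂ) one_pos] with x hx
  have hx' : ‖x‖ < 1 := by simpa using hx
  exact (hF.2 x hx').unique (hG.2 x hx')

theorem apply_zero (hF : IsCutSeries h F) : F 0 = h 0 := by
  refine (hF.2 0 (by simp)).unique ?_
  convert hasSum_single (f := fun n : ℕ => h n * (0 : ℂ) ^ n) 0 (fun n hn => by simp [hn]) using 1
  simp

theorem congr (hF : IsCutSeries h F) (hg : ∀ n, h n = g n) : IsCutSeries g F := by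
  rwa [← funext hg]

theorem add (hF : IsCutSeries h F) (hG : IsCutSeries g G) :
    IsCutSeries (fun n => h n + g n) (fun x => F x + G x) :=
  ⟨hF.1.add hG.1, fun x hx => by simpa [add_mul] using (hF.2 x hx).add (hG.2 x hx)⟩

theorem const_mul (hF : IsCutSeries h F) (c : ℂ) :
    IsCutSeries (fun n => c * h n) (fun x => c * F x) :=
  ⟨analyticOnNhd_const.mul hF.1, fun x hx => by
    simpa [mul_assoc] using (hF.2 x hx).mul_left c⟩

end IsCutSeries

open Finset in
theorem HasSum.mul_antidiagonal {u v : ℕ → ℂ} {A B : ℂ} (hu : HasSum u A) (hv : HasSum v B) :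
    HasSum (fun n => ∑ p ∈ HasAntidiagonal.antidiagonal n, u p.1 * v p.2) (A * B) := by
  have n1 : Summable fun n => ‖u n‖ := summable_norm_iff.2 hu.summable
  have n2 : Summable fun n => ‖v n‖ := summable_norm_iff.2 hv.summable
  have hs := (summable_norm_sum_mul_antidiagonal_of_summable_norm n1 n2).of_norm
  have ht := tsum_mul_tsum_eq_tsum_sum_antidiagonal_of_summable_norm n1 n2
  rw [← hu.tsum_eq, ← hv.tsum_eq, ht]
  exact hs.hasSum

namespace IsCutSeries

variable {h g : ℕ → ℂ} {F G : ℂ → ℂ}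

open Finset in
theorem mul (hF : IsCutSeries h F) (hG : IsCutSeries g G) :
    IsCutSeries (fun n => ∑ p ∈ HasAntidiagonal.antidiagonal n, h p.1 * g p.2)
      (fun x => F x * G x) := by
  refine ⟨hF.1.mul hG.1, fun x hx => ?_⟩
  refine ((hF.2 x hx).mul_antidiagonal (hG.2 x hx)).congr_fun fun n => ?_
  rw [sum_mul]
  refine sum_congr rfl fun p hp => ?_
  rw [← HasAntidiagonal.mem_antidiagonal.1 hp, pow_add]
  ring

theorem hasFPowerSeriesOnBall (hF : IsCutSeries h F) :
    HasFPowerSeriesOnBall F (FormalMultilinearSeries.ofScalars ℂ h) 0 1 := by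
  refine ⟨?_, one_pos, fun {y} hy => ?_⟩
  · refine ENNReal.le_of_forall_nnreal_lt fun r hr => ?_
    refine FormalMultilinearSeries.le_radius_of_summable_norm _ ?_
    have hr1 : (r : ℝ) < 1 := by exact_mod_cast hr
    have := summable_norm_iff.2 (hF.2 (r : ℝ) (by simpa using hr1)).summable
    simpa [FormalMultilinearSeries.ofScalars_norm] using this
  · have hy' : ‖y‖ < 1 := by simpa [edist_zero_right, ← ofReal_norm] using hy
    simpa [FormalMultilinearSeries.ofScalars_apply_eq, mul_comm] using hF.2 y hy'

theorem dslope (hF : IsCutSeries h F) : IsCutSeries (fun n => h (n + 1)) (dslope F 0) := by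
  refine ⟨?_, fun x hx => ?_⟩
  · rw [Complex.analyticOnNhd_iff_differentiableOn isOpen_cutPlane,
      Complex.differentiableOn_dslope (isOpen_cutPlane.mem_nhds zero_mem_cutPlane)]
    exact hF.1.differentiableOn
  · rcases eq_or_ne x 0 with rfl | hx0
    · rw [dslope_same, hF.hasFPowerSeriesOnBall.hasFPowerSeriesAt.deriv]
      rw [FormalMultilinearSeries.ofScalars_apply_eq]
      convert hasSum_single (f := fun n : ℕ => h (n + 1) * (0 : ℂ) ^ n) 0
        (fun n hn => by simp [hn]) using 1
      simp
    · rw [dslope_of_ne _ hx0, slope_def_field, hF.apply_zero]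
      have h1 := (hasSum_nat_add_iff' 1).2 (hF.2 x hx)
      simp only [Finset.range_one, Finset.sum_singleton, pow_zero, mul_one] at h1
      rw [sub_zero]
      refine (h1.div_const x).congr_fun fun n => ?_
      rw [pow_succ]
      field_simp

theorem eq_add_mul_dslope (hF : IsCutSeries h F) (x : ℂ) :
    F x = h 0 + x * _root_.dslope F 0 x := by
  have := sub_smul_dslope F 0 x
  rw [hF.apply_zero] at this
  simp only [sub_zero, smul_eq_mul] at this
  rw [this]
  ring

theorem of_add_mul (hG : IsCutSeries (fun n => h (n + 1)) G) :
    IsCutSeries h (fun x => h 0 + x * G x) := by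
  refine ⟨analyticOnNhd_const.add (analyticOnNhd_id.mul hG.1), fun x hx => ?_⟩
  rw [← hasSum_nat_add_iff' 1]
  simp only [Finset.range_one, Finset.sum_singleton, pow_zero, mul_one, add_sub_cancel_left]
  refine ((hG.2 x hx).mul_left x).congr_fun fun n => ?_
  rw [pow_succ]
  ring

end IsCutSeries

/-! ### Existence of the continuation -/

theorem isCutSeries_finite {h : ℕ → ℂ} (p : ℕ) (hp : ∀ n, p < n → h n = 0) :
    ∃ F, IsCutSeries h F := by
  refine ⟨fun x => ∑ n ∈ Finset.range (p + 1), h n * x ^ n, ?_, fun x _ => ?_⟩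
  · have : Differentiable ℂ fun x : ℂ => ∑ n ∈ Finset.range (p + 1), h n * x ^ n := by fun_prop
    exact fun x _ => this.analyticAt x
  · refine hasSum_sum_of_ne_finset_zero fun n hn => ?_
    rw [hp n (by simpa using hn), zero_mul]

theorem isCutSeries_one_sub_cpow (b : ℂ) :
    IsCutSeries (fun n => poch (-b) n / (n.factorial : ℂ)) (fun x => (1 - x) ^ b) := by
  refine ⟨fun x hx => ?_, fun x hx => ?_⟩
  · exact (analyticAt_const.sub analyticAt_id).cpow analyticAt_const ((mem_cutPlane_iff x).1 hx)
  · have h := (Complex.one_div_one_sub_cpow_hasFPowerSeriesOnBall_zero (-b)).hasSum (y := x)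
      (by simpa [edist_zero_right, ← ofReal_norm] using hx)
    simp only [FormalMultilinearSeries.ofScalars_apply_eq, zero_add, Complex.cpow_neg, one_div,
      inv_inv, smul_eq_mul] at h
    refine h.congr_fun fun n => ?_
    have h1 := Ring.factorial_nsmul_multichoose_eq_ascPochhammer (-b) n
    rw [Polynomial.ascPochhammer_smeval_eq_eval, nsmul_eq_mul] at h1
    beta_reduce
    rw [← Ring.multichoose_eq, poch, ← h1,
      mul_div_cancel_left₀ _ (Nat.cast_ne_zero.2 n.factorial_ne_zero)]

-- Termwise integration with `∫ t^(n+s-1) dt = 1 / (n + s)`; `Re s > 1` keeps `t^(s-1)` continuous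
-- and bounded by `1` on `[0, 1]`.
open MeasureTheory Set intervalIntegral in
theorem hasSum_integral_cpow_mul {h : ℕ → ℂ} {F : ℂ → ℂ} (hF : IsCutSeries h F) {s : ℂ}
    (hs : 1 < s.re) {x : ℂ} (hx : ‖x‖ < 1) :
    HasSum (fun n : ℕ => h n / (n + s) * x ^ n)
      (∫ t in (0 : ℝ)..1, (t : ℂ) ^ (s - 1) * F (t * x)) := by
  have hc : Continuous fun t : ℝ => (t : ℂ) ^ (s - 1) :=
    Complex.continuous_ofReal_cpow_const (by simpa using hs)
  have key := intervalIntegral.hasSum_integral_of_dominated_convergence (a := 0) (b := 1)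
    (μ := volume) (F := fun (n : ℕ) (t : ℝ) => (t : ℂ) ^ (s - 1) * (h n * (t * x) ^ n))
    (f := fun t : ℝ => (t : ℂ) ^ (s - 1) * F (t * x))
    (fun n _ => ‖h n * x ^ n‖) (fun n => ?_) (fun n => ?_) ?_ ?_ ?_
  · refine key.congr_fun fun n => ?_
    have h1 : ∀ t : ℝ, t ∈ uIcc (0 : ℝ) 1 → (t : ℂ) ^ (s - 1) * (h n * (t * x) ^ n) =
        h n * x ^ n * (t : ℂ) ^ (n + s - 1) := by
      intro t ht
      rw [uIcc_of_le zero_le_one] at ht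
      rcases ht.1.eq_or_lt with h0 | h0
      · rw [← h0]
        have e1 : s - 1 ≠ 0 := fun h => by
          have := congrArg Complex.re h
          simp at this
          linarith
        have e2 : (n : ℂ) + s - 1 ≠ 0 := fun h => by
          have := congrArg Complex.re h
          simp at this
          linarith [(Nat.cast_nonneg n : (0 : ℝ) ≤ n)]
        simp [Complex.zero_cpow e1, Complex.zero_cpow e2]
      · have h0' : (t : ℂ) ≠ 0 := by exact_mod_cast h0.ne'
        rw [show (n : ℂ) + s - 1 = n + (s - 1) by ring, Complex.cpow_add _ _ h0',
          Complex.cpow_natCast, mul_pow]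
        ring
    have hre : -1 < ((n : ℂ) + s - 1).re := by
      simp
      linarith [(Nat.cast_nonneg n : (0 : ℝ) ≤ n)]
    have e3 : (n : ℂ) + s ≠ 0 := fun h => by
      have := congrArg Complex.re h
      simp at this
      linarith [(Nat.cast_nonneg n : (0 : ℝ) ≤ n)]
    rw [intervalIntegral.integral_congr h1, intervalIntegral.integral_const_mul,
      integral_cpow (Or.inl hre), sub_add_cancel]
    simp only [Complex.ofReal_one, Complex.one_cpow, Complex.ofReal_zero, Complex.zero_cpow e3]
    ring
  · exact (by fun_prop : Continuous fun t : ℝ =>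
      (t : ℂ) ^ (s - 1) * (h n * (t * x) ^ n)).aestronglyMeasurable
  · refine Filter.Eventually.of_forall fun t ht => ?_
    rw [uIoc_of_le zero_le_one] at ht
    have h1 : ‖(t : ℂ) ^ (s - 1)‖ ≤ 1 := by
      rw [Complex.norm_cpow_eq_rpow_re_of_pos ht.1]
      exact Real.rpow_le_one ht.1.le ht.2 (by simp; linarith)
    have h2 : ‖(t : ℂ)‖ ^ n ≤ 1 := by
      refine pow_le_one₀ (norm_nonneg _) ?_
      rw [Complex.norm_real, Real.norm_of_nonneg ht.1.le]
      exact ht.2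
    rw [mul_pow, norm_mul, norm_mul, norm_mul, norm_pow, norm_mul]
    calc _ ≤ 1 * (‖h n‖ * (1 * ‖x ^ n‖)) := by gcongr
      _ = _ := by ring
  · exact Filter.Eventually.of_forall fun t ht => summable_norm_iff.2 (hF.2 x hx).summable
  · exact intervalIntegrable_const
  · refine Filter.Eventually.of_forall fun t ht => ?_
    rw [uIoc_of_le zero_le_one] at ht
    refine (hF.2 (t * x) ?_).mul_left _
    rw [norm_mul, Complex.norm_real, Real.norm_of_nonneg ht.1.le]
    nlinarith [norm_nonneg x, ht.2]

-- Differentiation under the integral: the cut plane is star-shaped about `0`, so the segments from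
-- `0` to a small closed ball sweep out a compact subset, on which `F'` is bounded.
open MeasureTheory Set Metric in
theorem differentiableOn_integral_cpow_mul {F : ℂ → ℂ} (hF : AnalyticOnNhd ℂ F cutPlane) {s : ℂ}
    (hs : 1 < s.re) :
    DifferentiableOn ℂ (fun x => ∫ t in (0 : ℝ)..1, (t : ℂ) ^ (s - 1) * F (t * x)) cutPlane := by
  intro x₀ hx₀
  have hc : Continuous fun t : ℝ => (t : ℂ) ^ (s - 1) :=
    Complex.continuous_ofReal_cpow_const (by simpa using hs)
  have hcont : ∀ {H : ℂ → ℂ}, AnalyticOnNhd ℂ H cutPlane → ∀ x ∈ cutPlane,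
      ContinuousOn (fun t : ℝ => H (t * x)) (Icc 0 1) := by
    intro H hH x hx
    exact hH.continuousOn.comp (by fun_prop) fun t ht => smul_mem_cutPlane hx ht
  obtain ⟨ε, hε, hball⟩ := nhds_basis_closedBall.mem_iff.1 (isOpen_cutPlane.mem_nhds hx₀)
  have hK : IsCompact ((fun p : ℝ × ℂ => (p.1 : ℂ) * p.2) '' (Icc (0 : ℝ) 1 ×ˢ closedBall x₀ ε)) :=
    (isCompact_Icc.prod (isCompact_closedBall x₀ ε)).image (by fun_prop)
  obtain ⟨C, hC⟩ := hK.exists_bound_of_continuousOn (f := deriv F) (hF.deriv.continuousOn.mono (by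
    rintro _ ⟨⟨t, x⟩, ⟨ht, hx⟩, rfl⟩
    exact smul_mem_cutPlane (hball hx) ht))
  have hmeas : ∀ {H : ℝ → ℂ}, ContinuousOn H (Icc 0 1) →
      AEStronglyMeasurable H (volume.restrict (uIoc 0 1)) := by
    intro H hH
    rw [uIoc_of_le zero_le_one]
    exact (hH.mono Ioc_subset_Icc_self).aestronglyMeasurable measurableSet_Ioc
  have hd := intervalIntegral.hasDerivAt_integral_of_dominated_loc_of_deriv_le (𝕜 := ℂ)
    (a := 0) (b := 1) (μ := volume) (x₀ := x₀) (s := ball x₀ ε) (bound := fun _ => C)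
    (F := fun (x : ℂ) (t : ℝ) => (t : ℂ) ^ (s - 1) * F (t * x))
    (F' := fun (x : ℂ) (t : ℝ) => (t : ℂ) ^ (s - 1) * (deriv F (t * x) * t))
    (ball_mem_nhds x₀ hε) ?_ ?_ ?_ ?_ ?_ ?_
  · exact hd.2.differentiableAt.differentiableWithinAt
  · filter_upwards [isOpen_cutPlane.mem_nhds hx₀] with x hx
    exact hmeas (hc.continuousOn.mul (hcont hF x hx))
  · refine ContinuousOn.intervalIntegrable ?_
    rw [uIcc_of_le zero_le_one]
    exact hc.continuousOn.mul (hcont hF x₀ hx₀)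
  · exact hmeas (hc.continuousOn.mul ((hcont hF.deriv x₀ hx₀).mul (by fun_prop)))
  · refine Filter.Eventually.of_forall fun t ht x hx => ?_
    rw [uIoc_of_le zero_le_one] at ht
    have h1 : ‖(t : ℂ) ^ (s - 1)‖ ≤ 1 := by
      rw [Complex.norm_cpow_eq_rpow_re_of_pos ht.1]
      exact Real.rpow_le_one ht.1.le ht.2 (by simp; linarith)
    have h2 : ‖(t : ℂ)‖ ≤ 1 := by
      rw [Complex.norm_real, Real.norm_of_nonneg ht.1.le]
      exact ht.2
    have h3 := hC _ ⟨(t, x), ⟨⟨ht.1.le, ht.2⟩, ball_subset_closedBall hx⟩, rfl⟩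
    have h4 : 0 ≤ C := (norm_nonneg _).trans h3
    rw [norm_mul, norm_mul]
    calc _ ≤ 1 * (C * 1) := by gcongr
      _ = C := by ring
  · exact intervalIntegrable_const
  · refine Filter.Eventually.of_forall fun t ht x hx => ?_
    rw [uIoc_of_le zero_le_one] at ht
    have hm := smul_mem_cutPlane (hball (ball_subset_closedBall hx)) ⟨ht.1.le, ht.2⟩
    have h1 : HasDerivAt (fun x : ℂ => (t : ℂ) * x) t x := by
      simpa using (hasDerivAt_id x).const_mul (t : ℂ)
    exact ((hF _ hm).differentiableAt.hasDerivAt.comp x h1).const_mul _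

/-- Division of the Taylor coefficients by `n + s`; a vanishing `n + s` gives the coefficient `0`. -/
theorem exists_isCutSeries_div_add {h : ℕ → ℂ} {F : ℂ → ℂ} (hF : IsCutSeries h F) (s : ℂ) :
    ∃ G, IsCutSeries (fun n => h n / (n + s)) G := by
  obtain ⟨N, hN⟩ := exists_nat_gt (1 - s.re)
  induction N generalizing h F s with
  | zero =>
    have hs : 1 < s.re := by
      simp at hN
      linarith
    exact ⟨_, (differentiableOn_integral_cpow_mul hF.1 hs).analyticOnNhd isOpen_cutPlane,
      fun x hx => hasSum_integral_cpow_mul hF hs hx⟩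
  | succ N ih =>
    -- Dropping the constant term replaces `s` by `s + 1`, until the integral applies; `of_add_mul`
    -- restores the constant term afterwards.
    obtain ⟨G, hG⟩ := ih hF.dslope (s + 1) (by
      push_cast at hN
      simp
      linarith)
    refine ⟨_, IsCutSeries.of_add_mul (G := G) (hG.congr fun n => ?_)⟩
    push_cast
    ring

theorem poch_succ_add (a : ℂ) (j n : ℕ) :
    poch (a + n) (j + 1) = poch (a + n) j * (n + (a + j)) := by
  rw [poch_succ]
  ring

theorem exists_isCutSeries_div_poch {h : ℕ → ℂ} {F : ℂ → ℂ} (hF : IsCutSeries h F) (a : ℂ)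
    (j : ℕ) : ∃ G, IsCutSeries (fun n => h n / poch (a + n) j) G := by
  induction j with
  | zero => exact ⟨F, hF.congr fun n => by simp [poch_zero]⟩
  | succ j ih =>
    obtain ⟨G, hG⟩ := ih
    obtain ⟨G', hG'⟩ := exists_isCutSeries_div_add hG (a + j)
    exact ⟨G', hG'.congr fun n => by rw [poch_succ_add, div_div]⟩

/-- Partial fractions: dividing `P` by `X + (a + j)`, the last factor of `(a + n)_{j+1}`, leaves a
quotient over `(a + n)_j` and a constant over `(a + n)_{j+1}`. -/
theorem exists_isCutSeries_eval_div_poch {h : ℕ → ℂ} {F : ℂ → ℂ} (hF : IsCutSeries h F) {a : ℂ}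
    (ha : ∀ n : ℕ, a ≠ -(n : ℂ)) (j : ℕ) (P : Polynomial ℂ) (hP : P.natDegree ≤ j) :
    ∃ G, IsCutSeries (fun n => h n * (P.eval (n : ℂ) / poch (a + n) j)) G := by
  induction j generalizing P with
  | zero =>
    refine ⟨_, (hF.const_mul (P.coeff 0)).congr fun n => ?_⟩
    rw [Polynomial.eq_C_of_natDegree_le_zero hP]
    simp [poch_zero, mul_comm]
  | succ j ih =>
    set z := -(a + j) with hz
    obtain ⟨G₁, h₁⟩ := ih (P /ₘ (Polynomial.X - Polynomial.C z)) (by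
      rw [Polynomial.natDegree_divByMonic _ (Polynomial.monic_X_sub_C z),
        Polynomial.natDegree_X_sub_C]
      omega)
    obtain ⟨G₂, h₂⟩ := exists_isCutSeries_div_poch hF a (j + 1)
    refine ⟨_, (h₁.add (h₂.const_mul (P.eval z))).congr fun n => ?_⟩
    have hdiv := congrArg (Polynomial.eval (n : ℂ))
      (Polynomial.modByMonic_add_div P (Polynomial.X - Polynomial.C z))
    rw [Polynomial.modByMonic_X_sub_C_eq_C_eval] at hdiv
    simp only [Polynomial.eval_add, Polynomial.eval_mul, Polynomial.eval_C, Polynomial.eval_sub,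
      Polynomial.eval_X] at hdiv
    have h0 : (n : ℂ) + (a + j) ≠ 0 := fun h => ha (n + j) (by
      push_cast
      linear_combination h)
    have h3 : poch (a + n) j ≠ 0 := poch_ne_zero fun i _ h => ha (n + i) (by
      push_cast
      linear_combination h)
    rw [poch_succ_add, ← hdiv, hz]
    field_simp
    ring

/-- Uses `(a)_n / (a + M)_n = (a)_M / (a + n)_M`. If `a` is a non-positive integer, `(a + n)_M` may
vanish, but then the series terminates. -/
theorem exists_isCutSeries_hypCoeff {r : ℕ} {a : ℂ} (b : ℂ) {f : Fin r → ℂ} {m : Fin r → ℕ} {M : ℕ}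
    (hM : M = ∑ i, m i) (hf : ∀ (i : Fin r) (n : ℕ), f i ≠ -(n : ℂ))
    (haM : ∀ n : ℕ, a + (M : ℂ) ≠ -(n : ℂ)) :
    ∃ F, IsCutSeries (hypCoeff (a ::ₘ b ::ₘ Finset.univ.val.map (fun i => f i + (m i : ℂ)))
      ((a + (M : ℂ)) ::ₘ Finset.univ.val.map f)) F := by
  by_cases ha : ∃ p : ℕ, a = -(p : ℂ)
  · obtain ⟨p, rfl⟩ := ha
    refine isCutSeries_finite p fun n hn => ?_
    rw [hypCoeff_eq, poch_neg_natCast_of_lt hn]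
    simp
  · push Not at ha
    obtain ⟨P, hP, hPe⟩ := exists_polynomial_ratio f m hf
    obtain ⟨G, hG⟩ := exists_isCutSeries_eval_div_poch (isCutSeries_one_sub_cpow (-b)) ha M P
      (hM ▸ hP)
    refine ⟨_, (hG.const_mul (poch a M)).congr fun n => ?_⟩
    have h1 : poch (a + M) n ≠ 0 := poch_ne_zero fun i _ => haM i
    have h2 : poch (a + n) M ≠ 0 := poch_ne_zero fun i _ h => ha (n + i) (by
      push_cast
      linear_combination h)
    have h3 := Nat.cast_ne_zero (R := ℂ).2 n.factorial_ne_zero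
    rw [hypCoeff_eq, hPe, neg_neg]
    generalize (∏ i, poch (f i + (m i : ℂ)) n) / ∏ i, poch (f i) n = R
    field_simp
    linear_combination (-(poch b n * R)) * poch_comm a M n

/-! ### Factorization over the roots and the main theorem -/

/-- Each root contributes `(g + 1 + n) (g + 1)_n = (g + 1) (g + 2)_n`. The cross-multiplied form
also covers `R = 0` and a root at `-1`. -/
theorem eval_mul_prod_poch (R : Polynomial ℂ) (n : ℕ) :
    R.eval (-((n + 1 : ℕ) : ℂ)) * (R.roots.map fun g => poch (g + 1) n).prod =
      R.eval (-1) * (R.roots.map fun g => poch (g + 2) n).prod := by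
  rw [(IsAlgClosed.splits R).eval_eq_prod_roots, (IsAlgClosed.splits R).eval_eq_prod_roots,
    mul_assoc, mul_assoc, ← Multiset.prod_map_mul, ← Multiset.prod_map_mul]
  congr 2
  refine Multiset.map_congr rfl fun g _ => ?_
  have h : (g + 1) * poch (g + 2) n = poch (g + 1) n * (g + 1 + n) := by
    rw [← poch_succ, poch_succ_left, show g + 1 + 1 = g + 2 by ring]
  push_cast
  linear_combination h

theorem corollary2 (r : ℕ) (hr : 1 ≤ r) (m : Fin r → ℕ) (hm : ∀ i, 1 ≤ m i)
    (M : ℕ) (hM : M = ∑ i, m i) (a b : ℂ) (f : Fin r → ℂ)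
    -- the lower parameters `f` and `a + M` are not non-positive integers
    (hf : ∀ (i : Fin r) (n : ℕ), f i ≠ -(n : ℂ))
    (haM : ∀ n : ℕ, a + (M : ℂ) ≠ -(n : ℂ))
    (hab : ∀ k : ℕ, k < M → a - b ≠ -(k : ℂ))
    (hfa : r = 1 → M = 1 → ∀ i, f i ≠ a)
    -- the roots with their multiplicities
    (γ : Multiset ℂ) (hγ : γ = (polyRhat a b f m).roots)
    -- the lower parameters `γ + 1` are not non-positive integers
    (hγ1 : ∀ g ∈ γ, ∀ n : ℕ, g + 1 ≠ -(n : ℂ))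
    (x : ℂ) (hx : x ∈ cutPlane) :
    (1 - x) ^ b *
        hypF (a ::ₘ b ::ₘ Finset.univ.val.map (fun i => f i + (m i : ℂ)))
          ((a + (M : ℂ)) ::ₘ Finset.univ.val.map f) x =
      1 + x * b *
        (a * (∏ i, (f i + (m i : ℂ))) / ((a + (M : ℂ)) * ∏ i, f i) - 1) *
        hypF (1 ::ₘ (a - b + 1) ::ₘ γ.map (fun g => g + 2))
          ((a + (M : ℂ) + 1) ::ₘ γ.map (fun g => g + 1)) x := by
  have hM1 : 1 ≤ M := by
    rw [hM]
    exact (hm ⟨0, hr⟩).trans (Finset.single_le_sum (f := m) (fun _ _ => Nat.zero_le _)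
      (Finset.mem_univ _))
  obtain ⟨F, hF⟩ := exists_isCutSeries_hypCoeff b hM hf haM
  have hE := (isCutSeries_one_sub_cpow b).mul hF
  have hpos := fun N (hN : 1 ≤ N) => sum_antidiagonal_hypCoeff (b := b) hM hM1 hf haM hab hN
  have h1 := hpos 1 le_rfl
  set κ : ℂ := b * (a * (∏ i, (f i + (m i : ℂ))) / ((a + (M : ℂ)) * ∏ i, f i) - 1) with hκ
  -- `κ` is the coefficient of `x`, computed directly and from the formula at `N = 1`.
  have hκ1 : κ = -((a - b) / (a + M)) * (polyRhat a b f m).eval (-1) := by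
    rw [Finset.Nat.sum_antidiagonal_succ] at h1
    simp only [Finset.Nat.antidiagonal_zero, Finset.sum_singleton, hypCoeff_eq, poch_one,
      poch_zero, Nat.factorial, Nat.cast_one, zero_add, Finset.prod_const_one] at h1
    rw [← h1, hκ, mul_comm (a + (M : ℂ)), ← div_mul_div_comm]
    ring
  have hcoeff : ∀ n : ℕ, ∑ p ∈ Finset.HasAntidiagonal.antidiagonal (n + 1),
      poch (-b) p.1 / (p.1.factorial : ℂ) *
        hypCoeff (a ::ₘ b ::ₘ Finset.univ.val.map (fun i => f i + (m i : ℂ)))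
          ((a + (M : ℂ)) ::ₘ Finset.univ.val.map f) p.2 =
      κ * hypCoeff (1 ::ₘ (a - b + 1) ::ₘ γ.map (fun g => g + 2))
          ((a + (M : ℂ) + 1) ::ₘ γ.map (fun g => g + 1)) n := by
    intro n
    have hR := eval_mul_prod_poch (polyRhat a b f m) n
    rw [← hγ] at hR
    have h2 : (γ.map fun g => poch (g + 1) n).prod ≠ 0 := by
      refine Multiset.prod_ne_zero fun h0 => ?_
      obtain ⟨g, hg, hg0⟩ := Multiset.mem_map.1 h0
      exact poch_ne_zero (fun i _ => hγ1 g hg i) hg0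
    have h3 := Nat.cast_ne_zero (R := ℂ).2 n.factorial_ne_zero
    have h4 : a + (M : ℂ) ≠ 0 := by simpa using haM 0
    have h5 : poch (a + M + 1) n ≠ 0 := poch_ne_zero fun i _ h => haM (i + 1) (by
      push_cast
      linear_combination h)
    rw [hpos _ (by omega), hκ1, hypCoeff]
    simp only [Multiset.map_cons, Multiset.prod_cons, Multiset.map_map, Function.comp_def]
    rw [poch_one_left, poch_succ_left, poch_succ_left]
    field_simp
    linear_combination (-((a - b) * poch (a - b + 1) n)) * hR
  have hD := hE.dslope.congr hcoeff
  have hval := hE.eq_add_mul_dslope x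
  simp only [Finset.Nat.antidiagonal_zero, Finset.sum_singleton, hypCoeff_eq, poch_zero,
    Nat.factorial, Nat.cast_one, Finset.prod_const_one, div_one, mul_one] at hval
  rw [hypF_spec hF hx, hval, mul_assoc x b, ← hκ, mul_assoc x κ]
  congr 2
  -- For `κ ≠ 0`, dividing `dslope` by `κ` gives the continuation of the right-hand series. For `κ =
  -- 0` that function is multiplied by `0`, and `dslope` vanishes with all its coefficients.
  rcases eq_or_ne κ 0 with h0 | h0
  · have hz : IsCutSeries (fun _ => 0) fun _ => 0 :=
      ⟨analyticOnNhd_const, fun y _ => by simp⟩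
    rw [h0, zero_mul]
    exact (hD.congr (g := fun _ => 0) fun n => by rw [h0, zero_mul]).eqOn hz hx
  · have hD' := (hD.const_mul κ⁻¹).congr fun n => inv_mul_cancel_left₀ h0 _
    rw [hypF_spec hD' hx, mul_inv_cancel_left₀ h0]
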